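/- Let $(F,g_F)$ be a connected smooth Riemannian manifold without boundary (finite-dimensional, Hausdorff, second countable), let $f\colon F\to(0,\infty)$ be smooth, let $-\infty\le t_1<t_2\le\infty$ and $I=(t_1,t_2)$. Let $M=I\times F$ carry the Lorentzian metric $g=-f^2\,dt^2\oplus g_F$ (a standard static space-time), and let $\mathrm{Ric}$ and $\tau$ be the Ricci tensor and the scalar curvature of $(M,g)$. Let $T$ be the 2-covariant tensor field on $M$ determined by Einstein's equation $$\mathrm{Ric}-\tfrac12\,\tau\, g=8\pi T .$$ On $(F,g_F)$ let $\mathrm{Ric}_{g_F}$ be the Ricci tensor, and set $Q^f_{g_F}=(\Delta_{g_F}f)\,g_F-H^f_{g_F}$, where $H^f_{g_F}$ is the Hessian tensor of $f$ and $\Delta_{g_F}f$ is its $g_F$-trace; write $\mathcal Q^f_{g_F}(v)=Q^f_{g_F}(v,v)$. A tensor is called positive (negative) semi-definite if its quadratic form is $\ge 0$ ($\le 0$) on every tangent space. A tangent vector $w\ne0$ of $M$ is causal if $g(w,w)\le 0$. 1. If $\mathrm{Ric}_{g_F}$ and $Q^f_{g_F}$ are both positive (respectively, both negative) semi-definite,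 then $T(w,w)\ge 0$ (respectively, $T(w,w)\le 0$) for every causal vector $w\in TM$. 2. If $(F,g_F)$ is Ricci flat, then for all $(t,p)\in M$, $u\in T_tI$ and $v\in T_pF$, $$8\pi\, T(u+v,u+v)=\frac{1}{f(p)}\,\mathcal Q^f_{g_F}(v).$$ Consequently, $Q^f_{g_F}$ is positive semi-definite if and only if $T(w,w)\ge 0$ for every vector $w\in TM$. -/

import Mathlib

set_option maxSynthPendingDepth 3

open scoped Manifold ContDiff

noncomputable section

namespace SemiRiemannian

/-! ### Curvature, Hessian and traces in coordinates

`E` is the coordinate space (finite-dimensional in all uses), and `g : E → (E →L[ℝ] E →L[ℝ] ℝ)` is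
the coordinate expression of a (semi-Riemannian) metric. -/

section Coordinates

variable {E : Type*} [NormedAddCommGroup E] [NormedSpace ℝ E]

/-- The trace `g^{ij} B_{ij}` of a bilinear form `B` with respect to a nondegenerate bilinear form
`g`: the trace of the endomorphism `g⁻¹ ∘ B` of `E`, where `g, B : E → E*`. -/
def formTrace (g B : E →L[ℝ] E →L[ℝ] ℝ) : ℝ :=
  LinearMap.trace ℝ E ((ContinuousLinearMap.inverse g ∘L B : E →L[ℝ] E) : E →ₗ[ℝ] E)

/-- The Christoffel symbols of the first kind, doubled:
`(v, w, u) ↦ (∂_v g)(w, u) + (∂_w g)(v, u) - (∂_u g)(v, w)`. -/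
def koszulForm (g : E → (E →L[ℝ] E →L[ℝ] ℝ)) (x : E) : E →L[ℝ] E →L[ℝ] E →L[ℝ] ℝ :=
  fderiv ℝ g x + (fderiv ℝ g x).flip
    - (ContinuousLinearMap.flipₗᵢ ℝ E E ℝ).toContinuousLinearEquiv.toContinuousLinearMap
        ∘L (fderiv ℝ g x).flip

/-- The Christoffel symbols of the second kind of the Levi-Civita connection of `g`:
`christoffel g x v w` is `∇_v w` at `x` for constant vector fields `v`, `w`. -/
def christoffel (g : E → (E →L[ℝ] E →L[ℝ] ℝ)) (x : E) : E →L[ℝ] E →L[ℝ] E :=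
  (1 / 2 : ℝ) • (ContinuousLinearMap.compL ℝ E (E →L[ℝ] ℝ) E
    (ContinuousLinearMap.inverse (g x)) ∘L koszulForm g x)

/-- The endomorphism `u ↦ R(u, v) w` of `E`, where
`R(u, v) w = ∇_u ∇_v w - ∇_v ∇_u w` (for constant fields `u`, `v`, `w`) is the curvature of the
Levi-Civita connection of `g`. -/
def curvatureEnd (g : E → (E →L[ℝ] E →L[ℝ] ℝ)) (x : E) (v w : E) : E →L[ℝ] E :=
  ((fderiv ℝ (christoffel g) x).flip v).flip w - (fderiv ℝ (christoffel g) x v).flip w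
    + (christoffel g x).flip (christoffel g x v w)
    - christoffel g x v ∘L (christoffel g x).flip w

/-- The Ricci tensor in coordinates, `Ric(v, w) = trace (u ↦ R(u, v) w)`. -/
def coordRicci (g : E → (E →L[ℝ] E →L[ℝ] ℝ)) (x : E) : LinearMap.BilinForm ℝ E :=
  LinearMap.mk₂ ℝ (fun v w ↦ LinearMap.trace ℝ E (curvatureEnd g x v w : E →ₗ[ℝ] E))
    (fun v v' w ↦ by
      rw [← map_add]; congr 1; ext u; simp [curvatureEnd]; abel)
    (fun c v w ↦ by
      rw [← map_smul]; congr 1; ext u; simp [curvatureEnd, smul_sub, smul_add])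
    (fun v w w' ↦ by
      rw [← map_add]; congr 1; ext u; simp [curvatureEnd]; abel)
    (fun c v w ↦ by
      rw [← map_smul]; congr 1; ext u; simp [curvatureEnd, smul_sub, smul_add])

/-- The Hessian `∇ d f` in coordinates: `H(v, w) = ∂_v ∂_w f - df (∇_v w)`. -/
def coordHessian (g : E → (E →L[ℝ] E →L[ℝ] ℝ)) (f : E → ℝ) (x : E) : E →L[ℝ] E →L[ℝ] ℝ :=
  fderiv ℝ (fderiv ℝ f) x
    - ContinuousLinearMap.compL ℝ E E ℝ (fderiv ℝ f x) ∘L christoffel g x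

end Coordinates

/-! ### Tensors on manifolds -/

section Manifold

variable {E : Type*} [NormedAddCommGroup E] [NormedSpace ℝ E]
  {H : Type*} [TopologicalSpace H] (J : ModelWithCorners ℝ E H)
  {M : Type*} [TopologicalSpace M] [ChartedSpace H M]

variable (M) in
/-- Fields of bilinear forms on the tangent spaces (2-covariant tensor fields). -/
abbrev BilinField := ∀ p : M, LinearMap.BilinForm ℝ (TangentSpace J p)

variable {J}

/-- A field of bilinear forms is positive semi-definite, at every point. -/
def PosSemidef (B : BilinField J M) : Prop :=
  ∀ (p : M) (v : TangentSpace J p), 0 ≤ B p v v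

/-- A field of bilinear forms is negative semi-definite, at every point. -/
def NegSemidef (B : BilinField J M) : Prop :=
  ∀ (p : M) (v : TangentSpace J p), B p v v ≤ 0

/-- A tangent vector is causal: nonzero, and timelike or null. -/
def IsCausal (g : BilinField J M) {p : M} (w : TangentSpace J p) : Prop :=
  w ≠ 0 ∧ g p w w ≤ 0

/-- The differential at `p` of the preferred chart around `p`. -/
def chartDeriv (J : ModelWithCorners ℝ E H) (p : M) : TangentSpace J p →ₗ[ℝ] E :=
  (mfderiv J 𝓘(ℝ, E) (extChartAt J p) p : TangentSpace J p →L[ℝ] E).toLinearMap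

variable [FiniteDimensional ℝ E]

/-- The expression of a field of bilinear forms in the preferred chart `φ` around `p`, that is, its
pullback under `φ⁻¹`. -/
def inChart (B : BilinField J M) (p : M) (x : E) : E →L[ℝ] E →L[ℝ] ℝ :=
  let D : E →ₗ[ℝ] TangentSpace J ((extChartAt J p).symm x) :=
    (mfderiv 𝓘(ℝ, E) J (extChartAt J p).symm x :
      E →L[ℝ] TangentSpace J ((extChartAt J p).symm x)).toLinearMap
  LinearMap.toContinuousBilinearMap ((B ((extChartAt J p).symm x)).compl₁₂ D D)

/-- The Ricci tensor of `g`. At `p` it is computed in the preferred chart around `p`. -/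
def ricci (g : BilinField J M) : BilinField J M := fun p ↦
  (coordRicci (inChart g p) (extChartAt J p p)).compl₁₂ (chartDeriv J p) (chartDeriv J p)

/-- The scalar curvature of `g`, the `g`-trace of its Ricci tensor. -/
def scalarCurvature (g : BilinField J M) (p : M) : ℝ :=
  formTrace (inChart g p (extChartAt J p p))
    (LinearMap.toContinuousBilinearMap (coordRicci (inChart g p) (extChartAt J p p)))

/-- The Hessian tensor of the function `f` with respect to `g`. -/
def hessian (g : BilinField J M) (f : M → ℝ) : BilinField J M := fun p ↦
  (ContinuousLinearMap.toBilinForm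
    (coordHessian (inChart g p) (f ∘ (extChartAt J p).symm) (extChartAt J p p))).compl₁₂
    (chartDeriv J p) (chartDeriv J p)

/-- The Laplace-Beltrami operator `Δ f = g^{ij} ∇_i ∇_j f`, the `g`-trace of the Hessian. -/
def laplacian (g : BilinField J M) (f : M → ℝ) (p : M) : ℝ :=
  formTrace (inChart g p (extChartAt J p p))
    (coordHessian (inChart g p) (f ∘ (extChartAt J p).symm) (extChartAt J p p))

/-- The tensor `Q = (Δ f) g - Hess f`. -/
def qTensor (g : BilinField J M) (f : M → ℝ) : BilinField J M := fun p ↦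
  laplacian g f p • g p - hessian g f p

/-- `T` satisfies Einstein's equation `Ric - (1/2) τ g = 8 π T`. -/
def EinsteinEquation (g T : BilinField J M) : Prop :=
  ∀ p : M, ricci g p - (1 / 2 * scalarCurvature g p) • g p = (8 * Real.pi) • T p

/-- The field of bilinear forms underlying a smooth Riemannian metric. -/
def riemannianForm [IsManifold J ∞ M]
    (g : Bundle.ContMDiffRiemannianMetric J ∞ E (fun p : M ↦ TangentSpace J p)) : BilinField J M :=
  fun p ↦ LinearMap.mk₂ ℝ (fun v w ↦ g.inner p v w)
    (by simp) (by simp) (by simp) (by simp)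

end Manifold

/-! ### Standard static space-times -/

/-- The open interval `(t₁, t₂)` of the real line, where `-∞ ≤ t₁` and `t₂ ≤ ∞`. -/
def timeInterval (t₁ t₂ : EReal) : TopologicalSpace.Opens ℝ where
  carrier := {t : ℝ | t₁ < (t : EReal) ∧ (t : EReal) < t₂}
  is_open' := isOpen_Ioo.preimage continuous_coe_real_ereal

section Static

variable {E : Type*} [NormedAddCommGroup E] [NormedSpace ℝ E]
  {F : Type*} [TopologicalSpace F] [ChartedSpace E F] {t₁ t₂ : EReal}

/-- The metric `-f² dt² ⊕ g_F` on `(t₁, t₂) × F`, with `dt` the differential of the coordinate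
function `(t, p) ↦ t` and `g_F` pulled back under the projection to `F`. -/
def staticMetric (t₁ t₂ : EReal) (f : F → ℝ) (gF : BilinField 𝓘(ℝ, E) F) :
    BilinField (𝓘(ℝ, ℝ).prod 𝓘(ℝ, E)) (timeInterval t₁ t₂ × F) := fun q ↦
  let dt : TangentSpace (𝓘(ℝ, ℝ).prod 𝓘(ℝ, E)) q →ₗ[ℝ] ℝ :=
    (mfderiv (𝓘(ℝ, ℝ).prod 𝓘(ℝ, E)) 𝓘(ℝ, ℝ)
      (fun q' : timeInterval t₁ t₂ × F ↦ (q'.1 : ℝ)) q :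
        TangentSpace (𝓘(ℝ, ℝ).prod 𝓘(ℝ, E)) q →L[ℝ] ℝ).toLinearMap
  let dπ : TangentSpace (𝓘(ℝ, ℝ).prod 𝓘(ℝ, E)) q →ₗ[ℝ] TangentSpace 𝓘(ℝ, E) q.2 :=
    (mfderiv (𝓘(ℝ, ℝ).prod 𝓘(ℝ, E)) 𝓘(ℝ, E)
      (Prod.snd : timeInterval t₁ t₂ × F → F) q).toLinearMap
  (gF q.2).compl₁₂ dπ dπ - (f q.2 ^ 2) • (LinearMap.mul ℝ ℝ).compl₁₂ dt dt

/-- The tangent vector `u + v` of `(t₁, t₂) × F` at `(t, p)`, for `u` tangent to the interval at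
`t` and `v` tangent to `F` at `p`: the sum of the images of `u` and `v` under the differentials of
the inclusions `t' ↦ (t', p)` and `p' ↦ (t, p')`. -/
def tangentSum {t : timeInterval t₁ t₂} {p : F} (u : TangentSpace 𝓘(ℝ, ℝ) t)
    (v : TangentSpace 𝓘(ℝ, E) p) : TangentSpace (𝓘(ℝ, ℝ).prod 𝓘(ℝ, E)) (t, p) :=
  mfderiv 𝓘(ℝ, ℝ) (𝓘(ℝ, ℝ).prod 𝓘(ℝ, E)) (fun t' : timeInterval t₁ t₂ ↦ (t', p)) t u
    + mfderiv 𝓘(ℝ, E) (𝓘(ℝ, ℝ).prod 𝓘(ℝ, E)) (fun p' : F ↦ (t, p')) p v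

end Static

end SemiRiemannian

end

open SemiRiemannian

noncomputable section

namespace SemiRiemannian

open Filter Topology ContinuousLinearMap

/-! ### Coordinate formulas and nondegenerate forms -/

section Coordinates

variable {E : Type*} [NormedAddCommGroup E] [NormedSpace ℝ E]

/-! Write `w = u + v` with `u` tangent to the interval and `v` tangent to `F`, let `a = dt(w)`, and
let `τ_F` be the scalar curvature of `g_F`. Everything follows from one identity
(`einstein_static`): `8π T(w,w) = Ric_F(v,v) + Q(v,v)/f - (1/2) τ_F g(w,w)`. For the static metric,
`Ric(w,w) = Ric_F(v,v) - H(v,v)/f + f Δf a²` and `τ = τ_F - 2 Δf/f`. In the Einstein tensor the term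
`f Δf a²` cancels the time part of `(Δf/f) g(w,w)`, and the rest of the `f` terms is `Q(v,v)/f`.

If `Ric_F` is semi-definite, its trace `τ_F` has the same sign; since `g(w,w) ≤ 0` on causal
vectors, all three terms then share that sign. If `Ric_F = 0`, only the `Q` term survives, for every
`w`.

The identity is proved in coordinates (`christoffel_coordStatic`, `coordRicci_coordStatic`,
`coordEinstein_coordStatic`) and carried to the manifold by `inChart_static`, which identifies the
static metric in a product chart with `coordStatic`. -/

theorem koszulForm_apply (g : E → (E →L[ℝ] E →L[ℝ] ℝ)) (x v w u : E) :
    koszulForm g x v w u = fderiv ℝ g x v w u + fderiv ℝ g x w v u - fderiv ℝ g x u v w := by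
  simp [koszulForm]

theorem christoffel_apply (g : E → (E →L[ℝ] E →L[ℝ] ℝ)) (x v w : E) :
    christoffel g x v w = (1 / 2 : ℝ) • inverse (g x) (koszulForm g x v w) := by
  simp [christoffel]

theorem curvatureEnd_apply (g : E → (E →L[ℝ] E →L[ℝ] ℝ)) (x v w u : E) :
    curvatureEnd g x v w u = fderiv ℝ (christoffel g) x u v w - fderiv ℝ (christoffel g) x v u w
      + christoffel g x u (christoffel g x v w) - christoffel g x v (christoffel g x u w) := by
  simp [curvatureEnd]

theorem coordRicci_apply (g : E → (E →L[ℝ] E →L[ℝ] ℝ)) (x v w : E) :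
    coordRicci g x v w = LinearMap.trace ℝ E (curvatureEnd g x v w : E →ₗ[ℝ] E) := rfl

theorem coordHessian_apply (g : E → (E →L[ℝ] E →L[ℝ] ℝ)) (f : E → ℝ) (x v w : E) :
    coordHessian g f x v w = fderiv ℝ (fderiv ℝ f) x v w - fderiv ℝ f x (christoffel g x v w) := by
  simp [coordHessian]

section Congr

variable {g g' : E → (E →L[ℝ] E →L[ℝ] ℝ)} {x : E}

theorem christoffel_congr (h : g =ᶠ[𝓝 x] g') : christoffel g =ᶠ[𝓝 x] christoffel g' := by
  filter_upwards [h, h.fderiv (𝕜 := ℝ)] with y hy hy'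
  simp only [christoffel, koszulForm, hy, hy']

/-- Curvature depends only on the germ of the metric. This matters because the chart expression of
the static metric is known only on the chart target. -/
theorem coordRicci_congr (h : g =ᶠ[𝓝 x] g') : coordRicci g x = coordRicci g' x := by
  have h₁ := christoffel_congr h
  ext v w
  simp only [coordRicci_apply, curvatureEnd, h₁.fderiv_eq, h₁.self_of_nhds]

end Congr

theorem fderiv_clm_apply₂ {E₁ E₂ E₃ E₄ : Type*} [NormedAddCommGroup E₁] [NormedSpace ℝ E₁]
    [NormedAddCommGroup E₂] [NormedSpace ℝ E₂] [NormedAddCommGroup E₃] [NormedSpace ℝ E₃]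
    [NormedAddCommGroup E₄] [NormedSpace ℝ E₄] {c : E₁ → E₂ →L[ℝ] E₃ →L[ℝ] E₄} {x : E₁}
    (hc : DifferentiableAt ℝ c x) (u : E₁) (v : E₂) (w : E₃) :
    fderiv ℝ c x u v w = fderiv ℝ (fun y ↦ c y v w) x u := by
  have h := (hc.hasFDerivAt.clm_apply (hasFDerivAt_const v x)).clm_apply (hasFDerivAt_const w x)
  simp [h.fderiv]

/-- A linear map on a finite-dimensional space amounts to its finitely many values on a basis, so
smoothness can be tested entry by entry. -/
theorem contDiffAt_of_clm_apply {E₁ E₂ E₃ : Type*} [NormedAddCommGroup E₁] [NormedSpace ℝ E₁]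
    [NormedAddCommGroup E₂] [NormedSpace ℝ E₂] [NormedAddCommGroup E₃] [NormedSpace ℝ E₃]
    [FiniteDimensional ℝ E₂] {n : WithTop ℕ∞} {c : E₁ → E₂ →L[ℝ] E₃} {x : E₁}
    (h : ∀ v, ContDiffAt ℝ n (fun y ↦ c y v) x) : ContDiffAt ℝ n c x := by
  let e₁ := ContinuousLinearEquiv.ofFinrankEq
    (Module.finrank_fin_fun ℝ (n := Module.finrank ℝ E₂)).symm
  let e₂ := (e₁.arrowCongr (1 : E₃ ≃L[ℝ] E₃)).trans (ContinuousLinearEquiv.piRing (Fin _))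
  rw [← Function.id_comp c, ← e₂.symm_comp_self]
  exact e₂.symm.contDiff.contDiffAt.comp x (contDiffAt_pi.mpr fun i ↦ h _)

theorem isInvertible_of_nondegenerate [FiniteDimensional ℝ E] (g : E →L[ℝ] E →L[ℝ] ℝ)
    (hg : ∀ v, (∀ w, g v w = 0) → v = 0) : g.IsInvertible := by
  have hinj : Function.Injective g.toLinearMap := by
    rw [← LinearMap.ker_eq_bot, LinearMap.ker_eq_bot']
    exact fun v hv ↦ hg v fun w ↦ congrArg (fun η : E →L[ℝ] ℝ ↦ η w) hv
  have hdim : Module.finrank ℝ E = Module.finrank ℝ (E →L[ℝ] ℝ) := by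
    rw [← (LinearMap.toContinuousLinearMap (𝕜 := ℝ) (E := E) (F' := ℝ)).finrank_eq]
    exact (Subspace.dual_finrank_eq (K := ℝ) (V := E)).symm
  let e := LinearEquiv.ofInjectiveOfFinrankEq g.toLinearMap hinj hdim
  exact ⟨e.toContinuousLinearEquiv, by ext v w; rfl⟩

theorem isInvertible_of_pos [FiniteDimensional ℝ E] (g : E →L[ℝ] E →L[ℝ] ℝ)
    (hg : ∀ v, v ≠ 0 → 0 < g v v) : g.IsInvertible :=
  isInvertible_of_nondegenerate g fun v hv ↦ by
    by_contra hne
    exact (hg v hne).ne' (hv v)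

theorem apply_inverse {g : E →L[ℝ] E →L[ℝ] ℝ} (hg : g.IsInvertible) (η : E →L[ℝ] ℝ) :
    g (inverse g η) = η :=
  (hg.inverse_apply_eq.1 rfl).symm

theorem apply_christoffel {g : E → (E →L[ℝ] E →L[ℝ] ℝ)} {x : E} (hg : (g x).IsInvertible)
    (v w u : E) : g x (christoffel g x v w) u = 1 / 2 * koszulForm g x v w u := by
  rw [christoffel_apply, map_smul, apply_inverse hg]; simp

/-- The Koszul formula characterizes the connection, so a guessed value can be verified by pairing
with test vectors, without inverting the metric. -/
theorem christoffel_eq {g : E → (E →L[ℝ] E →L[ℝ] ℝ)} {x : E} (hg : (g x).IsInvertible)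
    {v w z : E} (h : ∀ u, g x z u = 1 / 2 * koszulForm g x v w u) : christoffel g x v w = z := by
  rw [christoffel_apply, ← map_smul]
  refine hg.inverse_apply_eq.2 ?_
  ext u
  simp [h]

theorem differentiableAt_christoffel [FiniteDimensional ℝ E] {g : E → (E →L[ℝ] E →L[ℝ] ℝ)} {x : E}
    (hg : ContDiffAt ℝ 2 g x) (hx : (g x).IsInvertible) :
    DifferentiableAt ℝ (christoffel g) x := by
  have : CompleteSpace E := FiniteDimensional.complete ℝ E
  have h₁ : DifferentiableAt ℝ (fun y ↦ inverse (g y)) x :=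
    ((hx.contDiffAt_map_inverse (n := 2)).comp x hg).differentiableAt (by norm_num)
  have h₂ : DifferentiableAt ℝ (fderiv ℝ g) x :=
    (hg.fderiv_right (m := 1) (by norm_num)).differentiableAt (by norm_num)
  have h₃ : DifferentiableAt ℝ (fun y ↦ (fderiv ℝ g y).flip) x :=
    (flipₗᵢ ℝ E E (E →L[ℝ] ℝ)).toContinuousLinearEquiv.toContinuousLinearMap.differentiableAt.comp
      x h₂
  have h₄ : DifferentiableAt ℝ (koszulForm g) x :=
    (h₂.add h₃).sub ((differentiableAt_const _).clm_comp h₃)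
  have h₅ : DifferentiableAt ℝ (fun y ↦ compL ℝ E (E →L[ℝ] ℝ) E (inverse (g y))) x :=
    (compL ℝ E (E →L[ℝ] ℝ) E).differentiableAt.comp x h₁
  exact (h₅.clm_comp h₄).const_smul (1 / 2 : ℝ)

/-! ### Metric compatibility and the gradient -/

section Gradient

variable {G : E → (E →L[ℝ] E →L[ℝ] ℝ)} {f : E → ℝ} {x : E}

/-- The gradient of `f` with respect to `g`, in coordinates. -/
def coordGradient (g : E → (E →L[ℝ] E →L[ℝ] ℝ)) (f : E → ℝ) (x : E) : E :=
  inverse (g x) (fderiv ℝ f x)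

theorem apply_coordGradient (hG : (G x).IsInvertible) (v : E) :
    G x (coordGradient G f x) v = fderiv ℝ f x v := by
  rw [coordGradient, apply_inverse hG]

theorem fderiv_symm (hG : DifferentiableAt ℝ G x) (hsymm : ∀ᶠ y in 𝓝 x, ∀ v w, G y v w = G y w v)
    (u v w : E) : fderiv ℝ G x u v w = fderiv ℝ G x u w v := by
  rw [fderiv_clm_apply₂ hG, fderiv_clm_apply₂ hG]
  congr 1
  refine EventuallyEq.fderiv_eq ?_
  filter_upwards [hsymm] with y hy using hy v w

/-- This is `∇g = 0`: in the sum of the two Koszul expressions, symmetry of `g` cancels all but the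
derivative along `u`. -/
theorem christoffel_metric (hG : DifferentiableAt ℝ G x) (hx : (G x).IsInvertible)
    (hsymm : ∀ᶠ y in 𝓝 x, ∀ v w, G y v w = G y w v) (u v w : E) :
    fderiv ℝ G x u v w = G x (christoffel G x u v) w + G x (christoffel G x u w) v := by
  rw [apply_christoffel hx, apply_christoffel hx, koszulForm_apply, koszulForm_apply,
    fderiv_symm hG hsymm u w v, fderiv_symm hG hsymm v u w, fderiv_symm hG hsymm w u v]
  ring

theorem differentiableAt_coordGradient [FiniteDimensional ℝ E] (hG : ContDiffAt ℝ 2 G x)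
    (hx : (G x).IsInvertible) (hf : ContDiffAt ℝ 2 f x) :
    DifferentiableAt ℝ (coordGradient G f) x := by
  have : CompleteSpace E := FiniteDimensional.complete ℝ E
  have h₁ : DifferentiableAt ℝ (fun y ↦ inverse (G y)) x :=
    ((hx.contDiffAt_map_inverse (n := 2)).comp x hG).differentiableAt (by norm_num)
  exact h₁.clm_apply ((hf.fderiv_right (m := 1) (by norm_num)).differentiableAt (by norm_num))

/-- The covariant derivative of the gradient is the Hessian with an index raised. -/
theorem fderiv_coordGradient_add [FiniteDimensional ℝ E] (hG : ContDiffAt ℝ 2 G x)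
    (hinv : ∀ᶠ y in 𝓝 x, (G y).IsInvertible) (hsymm : ∀ᶠ y in 𝓝 x, ∀ v w, G y v w = G y w v)
    (hf : ContDiffAt ℝ 2 f x) (u : E) :
    fderiv ℝ (coordGradient G f) x u + christoffel G x u (coordGradient G f x)
      = inverse (G x) (coordHessian G f x u) := by
  have hx := hinv.self_of_nhds
  have hG₁ := hG.differentiableAt (by norm_num)
  have hf₁ : DifferentiableAt ℝ (fderiv ℝ f) x :=
    (hf.fderiv_right (m := 1) (by norm_num)).differentiableAt (by norm_num)
  symm
  refine hx.inverse_apply_eq.2 ?_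
  ext w
  -- Differentiate `g(grad f, w) = df(w)` along `u`. Metric compatibility rewrites the derivative of
  -- `g`, and the leftover `g(∇_u w, grad f) = df(∇_u w)` is the correction term of the Hessian.
  have h₁ : (fun y ↦ G y (coordGradient G f y) w) =ᶠ[𝓝 x] fun y ↦ fderiv ℝ f y w := by
    filter_upwards [hinv] with y hy using apply_coordGradient hy w
  have h₂ := ((hG₁.hasFDerivAt.clm_apply
    (differentiableAt_coordGradient hG hx hf).hasFDerivAt).clm_apply
      (hasFDerivAt_const w x)).fderiv
  rw [h₁.fderiv_eq, (hf₁.hasFDerivAt.clm_apply (hasFDerivAt_const w x)).fderiv] at h₂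
  have h₃ := congrArg (fun η : E →L[ℝ] ℝ ↦ η u) h₂
  have h₄ := christoffel_metric hG₁ hx hsymm u (coordGradient G f x) w
  have h₅ := hsymm.self_of_nhds (christoffel G x u w) (coordGradient G f x)
  rw [apply_coordGradient hx] at h₅
  simp at h₃
  rw [coordHessian_apply, map_add, add_apply]
  linarith

end Gradient

/-! ### Traces on products and against definite forms -/

section Trace

variable [FiniteDimensional ℝ E]

/-- Split `A` through the two projections; cyclicity of the trace moves each summand onto its own
factor. -/
theorem trace_prod (A : (ℝ × E) →ₗ[ℝ] ℝ × E) :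
    LinearMap.trace ℝ (ℝ × E) A = (A (1, 0)).1
      + LinearMap.trace ℝ E (LinearMap.snd ℝ ℝ E ∘ₗ A ∘ₗ LinearMap.inr ℝ ℝ E) := by
  have hA : A = (A ∘ₗ LinearMap.inl ℝ ℝ E) ∘ₗ LinearMap.fst ℝ ℝ E
      + (A ∘ₗ LinearMap.inr ℝ ℝ E) ∘ₗ LinearMap.snd ℝ ℝ E := by
    ext <;> simp [Prod.mk_zero_zero]
  conv_lhs => rw [hA]
  rw [map_add, LinearMap.trace_comp_comm', LinearMap.trace_comp_comm' _ (LinearMap.snd ℝ ℝ E)]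
  congr 1
  rw [LinearMap.trace_eq_matrix_trace ℝ (Module.Basis.singleton Unit ℝ)]
  simp [Matrix.trace, LinearMap.toMatrix_apply]

/-- In a `g`-orthogonal basis the trace is a weighted sum of diagonal values of `B` with positive
weights, which makes its sign visible. -/
theorem exists_formTrace_eq_sum {g : E →L[ℝ] E →L[ℝ] ℝ} (hpos : ∀ v, v ≠ 0 → 0 < g v v)
    (hsymm : ∀ v w, g v w = g w v) :
    ∃ (n : ℕ) (e : Fin n → E), (∀ i, 0 < g (e i) (e i)) ∧
      ∀ B : E →L[ℝ] E →L[ℝ] ℝ, formTrace g B = ∑ i, B (e i) (e i) / g (e i) (e i) := by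
  have hinv := isInvertible_of_pos g hpos
  obtain ⟨b, hb⟩ := LinearMap.BilinForm.exists_orthogonal_basis (B := g.toBilinForm)
    ⟨fun v w ↦ hsymm v w⟩
  refine ⟨_, b, fun i ↦ hpos _ (b.ne_zero i), fun B ↦ ?_⟩
  rw [formTrace, LinearMap.trace_eq_matrix_trace ℝ b, Matrix.trace]
  refine Finset.sum_congr rfl fun i _ ↦ ?_
  rw [eq_div_iff (hpos _ (b.ne_zero i)).ne', Matrix.diag_apply, LinearMap.toMatrix_apply]
  set z : E := inverse g (B (b i)) with hz
  have h₁ : g z (b i) = B (b i) (b i) := by rw [hz, apply_inverse hinv]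
  -- By orthogonality, pairing with `b i` isolates the coordinate `b.repr z i`, which is the
  -- diagonal matrix entry.
  have h₂ : g z (b i) = b.repr z i * g (b i) (b i) := by
    conv_lhs => rw [← b.sum_repr z]
    rw [map_sum, sum_apply, Finset.sum_eq_single i]
    · simp
    · intro j _ hj
      have : g (b j) (b i) = 0 := hb hj
      simp [this]
    · simp
  rw [← h₁, h₂]
  rfl

theorem formTrace_nonneg {g B : E →L[ℝ] E →L[ℝ] ℝ} (hpos : ∀ v, v ≠ 0 → 0 < g v v)
    (hsymm : ∀ v w, g v w = g w v) (hB : ∀ v, 0 ≤ B v v) : 0 ≤ formTrace g B := by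
  obtain ⟨n, e, he, h⟩ := exists_formTrace_eq_sum hpos hsymm
  rw [h]
  exact Finset.sum_nonneg fun i _ ↦ div_nonneg (hB _) (he i).le

theorem formTrace_nonpos {g B : E →L[ℝ] E →L[ℝ] ℝ} (hpos : ∀ v, v ≠ 0 → 0 < g v v)
    (hsymm : ∀ v w, g v w = g w v) (hB : ∀ v, B v v ≤ 0) : formTrace g B ≤ 0 := by
  obtain ⟨n, e, he, h⟩ := exists_formTrace_eq_sum hpos hsymm
  rw [h]
  exact Finset.sum_nonpos fun i _ ↦ div_nonpos_of_nonpos_of_nonneg (hB _) (he i).le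

end Trace

end Coordinates

/-! ### Curvature of a static metric in coordinates -/

section CoordStatic

variable {E : Type*} [NormedAddCommGroup E] [NormedSpace ℝ E]

/-- The metric `-f² dt² ⊕ G` in coordinates. -/
def coordStatic (f : E → ℝ) (G : E → (E →L[ℝ] E →L[ℝ] ℝ)) (y : ℝ × E) :
    (ℝ × E) →L[ℝ] (ℝ × E) →L[ℝ] ℝ :=
  (G y.2).bilinearComp (snd ℝ ℝ E) (snd ℝ ℝ E)
    - (f y.2 ^ 2) • (ContinuousLinearMap.mul ℝ ℝ).bilinearComp (fst ℝ ℝ E) (fst ℝ ℝ E)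

variable {f : E → ℝ} {G : E → (E →L[ℝ] E →L[ℝ] ℝ)} {y : ℝ × E}

theorem coordStatic_apply (f : E → ℝ) (G : E → (E →L[ℝ] E →L[ℝ] ℝ)) (y V W : ℝ × E) :
    coordStatic f G y V W = G y.2 V.2 W.2 - f y.2 ^ 2 * (V.1 * W.1) := by
  simp [coordStatic]

theorem contDiffAt_coordStatic [FiniteDimensional ℝ E] (hG : ContDiffAt ℝ 2 G y.2)
    (hf : ContDiffAt ℝ 2 f y.2) : ContDiffAt ℝ 2 (coordStatic f G) y := by
  have hG' : ContDiffAt ℝ 2 (fun z : ℝ × E ↦ G z.2) y := hG.comp y contDiffAt_snd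
  have hf' : ContDiffAt ℝ 2 (fun z : ℝ × E ↦ f z.2) y := hf.comp y contDiffAt_snd
  refine contDiffAt_of_clm_apply fun V ↦ contDiffAt_of_clm_apply fun W ↦ ?_
  simp only [coordStatic_apply]
  exact ((hG'.clm_apply contDiffAt_const).clm_apply contDiffAt_const).sub
    ((hf'.pow 2).mul contDiffAt_const)

theorem isInvertible_coordStatic [FiniteDimensional ℝ E] (hG : (G y.2).IsInvertible)
    (hf : f y.2 ≠ 0) : (coordStatic f G y).IsInvertible := by
  refine isInvertible_of_nondegenerate _ fun V hV ↦ ?_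
  simp only [coordStatic_apply] at hV
  have h₁ : V.1 = 0 := by simpa [hf] using hV (1, 0)
  have h₂ : V.2 = 0 := by
    have : G y.2 V.2 = 0 := by ext w; simpa using hV (0, w)
    exact hG.injective (by simpa using this)
  exact Prod.ext h₁ h₂

/-- The metric is block diagonal, with time block `-f²`, so it is inverted block by block. -/
theorem inverse_coordStatic [FiniteDimensional ℝ E] (hG : (G y.2).IsInvertible)
    (hf : f y.2 ≠ 0) (η : (ℝ × E) →L[ℝ] ℝ) :
    inverse (coordStatic f G y) η
      = (-(η (1, 0)) / f y.2 ^ 2, inverse (G y.2) (η ∘L inr ℝ ℝ E)) := by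
  refine (isInvertible_coordStatic hG hf).inverse_apply_eq.2 ?_
  ext W
  · simp only [coordStatic_apply, apply_inverse hG, comp_apply]
    simp [Prod.mk_zero_zero]; field_simp
  · simp [coordStatic_apply, apply_inverse hG]

theorem formTrace_coordStatic [FiniteDimensional ℝ E] (hG : (G y.2).IsInvertible)
    (hf : f y.2 ≠ 0) (B : (ℝ × E) →L[ℝ] (ℝ × E) →L[ℝ] ℝ) :
    formTrace (coordStatic f G y) B = -(B (1, 0) (1, 0)) / f y.2 ^ 2
      + formTrace (G y.2) (B.bilinearComp (inr ℝ ℝ E) (inr ℝ ℝ E)) := by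
  rw [formTrace, trace_prod, formTrace]
  congr 1
  · simp [inverse_coordStatic hG hf]
  · congr 1
    ext u
    simp only [LinearMap.comp_apply, LinearMap.inr_apply, LinearMap.snd_apply, coe_coe,
      comp_apply, inverse_coordStatic hG hf]
    congr 1

theorem fderiv_coordStatic [FiniteDimensional ℝ E] (hG : ContDiffAt ℝ 2 G y.2)
    (hf : ContDiffAt ℝ 2 f y.2) (U V W : ℝ × E) :
    fderiv ℝ (coordStatic f G) y U V W = fderiv ℝ G y.2 U.2 V.2 W.2
      - 2 * f y.2 * fderiv ℝ f y.2 U.2 * (V.1 * W.1) := by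
  rw [fderiv_clm_apply₂ ((contDiffAt_coordStatic hG hf).differentiableAt (by norm_num))]
  simp only [coordStatic_apply]
  have hG' := ((((hG.differentiableAt (by norm_num)).hasFDerivAt.comp y
    hasFDerivAt_snd).clm_apply (hasFDerivAt_const V.2 y)).clm_apply (hasFDerivAt_const W.2 y))
  have hf' := ((((hf.differentiableAt (by norm_num)).hasFDerivAt.comp y
    hasFDerivAt_snd).pow 2).mul_const (V.1 * W.1))
  have h := (hG'.sub hf').fderiv
  simp only [Function.comp_apply] at h
  erw [h]
  simp
  ring

/-- Apart from `∂G`, the only derivative of the metric is `-2 f df ⊗ dt²`; it enters the Koszul form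
exactly where two of the three slots are in the time direction. -/
theorem christoffel_coordStatic [FiniteDimensional ℝ E] (hG : ContDiffAt ℝ 2 G y.2)
    (hinv : (G y.2).IsInvertible) (hf : ContDiffAt ℝ 2 f y.2) (hf₀ : f y.2 ≠ 0) (V W : ℝ × E) :
    christoffel (coordStatic f G) y V W
      = (V.1 * (fderiv ℝ f y.2 W.2 / f y.2) + W.1 * (fderiv ℝ f y.2 V.2 / f y.2),
        christoffel G y.2 V.2 W.2 + (V.1 * W.1) • (f y.2 • coordGradient G f y.2)) := by
  refine christoffel_eq (isInvertible_coordStatic hinv hf₀) fun U ↦ ?_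
  simp only [coordStatic_apply, map_add, map_smul, add_apply, smul_apply, smul_eq_mul,
    apply_christoffel hinv, apply_coordGradient hinv, koszulForm_apply, fderiv_coordStatic hG hf]
  field_simp
  ring

theorem fderiv_christoffel_coordStatic [FiniteDimensional ℝ E] (hG : ContDiffAt ℝ 2 G y.2)
    (hinv : ∀ᶠ x in 𝓝 y.2, (G x).IsInvertible) (hf : ContDiffAt ℝ 2 f y.2) (hf₀ : f y.2 ≠ 0)
    (U V W : ℝ × E) :
    fderiv ℝ (christoffel (coordStatic f G)) y U V W
      = (V.1 * (fderiv ℝ (fderiv ℝ f) y.2 U.2 W.2 / f y.2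
            - fderiv ℝ f y.2 W.2 * fderiv ℝ f y.2 U.2 / f y.2 ^ 2)
          + W.1 * (fderiv ℝ (fderiv ℝ f) y.2 U.2 V.2 / f y.2
            - fderiv ℝ f y.2 V.2 * fderiv ℝ f y.2 U.2 / f y.2 ^ 2),
        fderiv ℝ (christoffel G) y.2 U.2 V.2 W.2
          + (V.1 * W.1) • (fderiv ℝ f y.2 U.2 • coordGradient G f y.2
            + f y.2 • fderiv ℝ (coordGradient G f) y.2 U.2)) := by
  have hx := hinv.self_of_nhds
  have hsnd : Tendsto (Prod.snd : ℝ × E → E) (𝓝 y) (𝓝 y.2) := continuous_snd.continuousAt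
  rw [fderiv_clm_apply₂ (differentiableAt_christoffel (contDiffAt_coordStatic hG hf)
    (isInvertible_coordStatic hx hf₀))]
  -- The closed formula holds on a neighbourhood, so it may be differentiated in place of the
  -- Christoffel symbols.
  have hev : (fun z ↦ christoffel (coordStatic f G) z V W) =ᶠ[𝓝 y]
      fun z ↦ (V.1 * (fderiv ℝ f z.2 W.2 / f z.2) + W.1 * (fderiv ℝ f z.2 V.2 / f z.2),
        christoffel G z.2 V.2 W.2 + (V.1 * W.1) • (f z.2 • coordGradient G f z.2)) := by
    filter_upwards [hsnd.eventually (hG.eventually (by simp)), hsnd.eventually hinv,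
      hsnd.eventually (hf.eventually (by simp)),
      hsnd.eventually (hf.continuousAt.eventually_ne hf₀)] with z h₁ h₂ h₃ h₄
      using christoffel_coordStatic h₁ h₂ h₃ h₄ V W
  rw [hev.fderiv_eq]
  have hf₁ : HasFDerivAt (fun x ↦ f x) (fderiv ℝ f y.2) y.2 :=
    (hf.differentiableAt (by norm_num)).hasFDerivAt
  have hf₂ : DifferentiableAt ℝ (fderiv ℝ f) y.2 :=
    (hf.fderiv_right (m := 1) (by norm_num)).differentiableAt (by norm_num)
  have hθ (w : E) : HasFDerivAt (fun x ↦ fderiv ℝ f x w / f x) _ y.2 :=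
    (hf₂.hasFDerivAt.clm_apply (hasFDerivAt_const w y.2)).mul
      ((hasDerivAt_inv hf₀).comp_hasFDerivAt y.2 hf₁)
  have hΓ := ((differentiableAt_christoffel hG hx).hasFDerivAt.clm_apply
    (hasFDerivAt_const V.2 y.2)).clm_apply (hasFDerivAt_const W.2 y.2)
  have hN := (hf₁.fun_smul (differentiableAt_coordGradient hG hx hf).hasFDerivAt).const_smul
    (V.1 * W.1)
  have h₁ := (((hθ W.2).const_mul V.1).add ((hθ V.2).const_mul W.1))
  have h := ((h₁.prodMk (hΓ.add hN)).comp y hasFDerivAt_snd).fderiv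
  refine (congrArg (fun A : (ℝ × E) →L[ℝ] ℝ × E ↦ A U) h).trans ?_
  refine Prod.ext ?_ ?_
  · simp
    field_simp
    ring
  · simp
    exact add_comm _ _

/-- The trace splits by `trace_prod`. The time entry of the curvature gives `-H/f`; the space block
is the curvature of `G` plus a multiple of the covariant derivative of `grad f`, whose trace is the
Laplacian. -/
theorem coordRicci_coordStatic [FiniteDimensional ℝ E] (hG : ContDiffAt ℝ 2 G y.2)
    (hinv : ∀ᶠ x in 𝓝 y.2, (G x).IsInvertible)
    (hsymm : ∀ᶠ x in 𝓝 y.2, ∀ v w, G x v w = G x w v)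
    (hf : ContDiffAt ℝ 2 f y.2) (hf₀ : f y.2 ≠ 0) (V W : ℝ × E) :
    coordRicci (coordStatic f G) y V W = coordRicci G y.2 V.2 W.2
      - coordHessian G f y.2 V.2 W.2 / f y.2
      + f y.2 * formTrace (G y.2) (coordHessian G f y.2) * (V.1 * W.1) := by
  have hx := hinv.self_of_nhds
  have hsnd : LinearMap.snd ℝ ℝ E ∘ₗ
        (curvatureEnd (coordStatic f G) y V W : (ℝ × E) →ₗ[ℝ] ℝ × E) ∘ₗ LinearMap.inr ℝ ℝ E
      = (curvatureEnd G y.2 V.2 W.2 : E →ₗ[ℝ] E) + (V.1 * W.1 * f y.2) •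
        ((inverse (G y.2) ∘L coordHessian G f y.2 : E →L[ℝ] E) : E →ₗ[ℝ] E) := by
    ext u
    simp only [LinearMap.comp_apply, LinearMap.inr_apply, LinearMap.snd_apply, coe_coe,
      LinearMap.add_apply, LinearMap.smul_apply, curvatureEnd_apply,
      fderiv_christoffel_coordStatic hG hinv hf hf₀, christoffel_coordStatic hG hx hf hf₀,
      comp_apply, ← fderiv_coordGradient_add hG hinv hsymm hf u]
    simp only [Prod.snd_add, Prod.snd_sub, map_add, map_smul, zero_mul, zero_smul, zero_add,
      add_zero, smul_add]
    have : f y.2 ≠ 0 := hf₀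
    match_scalars <;> field_simp
    ring
  have hfst : (curvatureEnd (coordStatic f G) y V W (1, 0)).1
      = -(coordHessian G f y.2 V.2 W.2 / f y.2) := by
    simp only [curvatureEnd_apply, fderiv_christoffel_coordStatic hG hinv hf hf₀,
      christoffel_coordStatic hG hx hf hf₀, coordHessian_apply]
    simp
    field_simp
    ring
  rw [coordRicci_apply, trace_prod, hsnd, map_add, map_smul, coordRicci_apply, formTrace]
  erw [hfst]
  simp only [smul_eq_mul]
  ring

/-- The Einstein tensor of a static metric in coordinates. -/
theorem coordEinstein_coordStatic [FiniteDimensional ℝ E] (hG : ContDiffAt ℝ 2 G y.2)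
    (hinv : ∀ᶠ x in 𝓝 y.2, (G x).IsInvertible)
    (hsymm : ∀ᶠ x in 𝓝 y.2, ∀ v w, G x v w = G x w v)
    (hf : ContDiffAt ℝ 2 f y.2) (hf₀ : f y.2 ≠ 0) (V : ℝ × E) :
    coordRicci (coordStatic f G) y V V
        - 1 / 2 * formTrace (coordStatic f G y)
          (LinearMap.toContinuousBilinearMap (coordRicci (coordStatic f G) y))
          * coordStatic f G y V V
      = coordRicci G y.2 V.2 V.2
        + 1 / f y.2 * (formTrace (G y.2) (coordHessian G f y.2) * G y.2 V.2 V.2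
          - coordHessian G f y.2 V.2 V.2)
        - 1 / 2 * formTrace (G y.2) (LinearMap.toContinuousBilinearMap (coordRicci G y.2))
          * coordStatic f G y V V := by
  have hx := hinv.self_of_nhds
  -- One `-Δf/f` comes from the time direction, the other from the trace of `-H/f` over the space
  -- block.
  have htr : formTrace (coordStatic f G y)
        (LinearMap.toContinuousBilinearMap (coordRicci (coordStatic f G) y))
      = formTrace (G y.2) (LinearMap.toContinuousBilinearMap (coordRicci G y.2))
        - 2 * formTrace (G y.2) (coordHessian G f y.2) / f y.2 := by
    have hB : (LinearMap.toContinuousBilinearMap (coordRicci (coordStatic f G) y)).bilinearComp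
          (inr ℝ ℝ E) (inr ℝ ℝ E)
        = LinearMap.toContinuousBilinearMap (coordRicci G y.2)
          - (1 / f y.2) • coordHessian G f y.2 := by
      ext v w
      simp [coordRicci_coordStatic hG hinv hsymm hf hf₀]
      ring
    have hlin : formTrace (G y.2) (LinearMap.toContinuousBilinearMap (coordRicci G y.2)
          - (1 / f y.2) • coordHessian G f y.2)
        = formTrace (G y.2) (LinearMap.toContinuousBilinearMap (coordRicci G y.2))
          - 1 / f y.2 * formTrace (G y.2) (coordHessian G f y.2) := by
      simp [formTrace, comp_sub]
    rw [formTrace_coordStatic hx hf₀, hB, hlin]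
    simp [coordRicci_coordStatic hG hinv hsymm hf hf₀]
    field_simp
    ring
  -- The `dt²` terms carrying `Δf` cancel here.
  rw [htr, coordRicci_coordStatic hG hinv hsymm hf hf₀, coordStatic_apply]
  field_simp
  ring

end CoordStatic

/-! ### A Riemannian metric read in a chart -/

section Riemannian

variable {E : Type*} [NormedAddCommGroup E] [NormedSpace ℝ E]
  {M : Type*} [TopologicalSpace M] [ChartedSpace E M] [IsManifold 𝓘(ℝ, E) ∞ M]

theorem mdifferentiableAt_extChartAt_symm' {p : M} {x : E}
    (hx : x ∈ (extChartAt 𝓘(ℝ, E) p).target) :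
    MDifferentiableAt 𝓘(ℝ, E) 𝓘(ℝ, E) (extChartAt 𝓘(ℝ, E) p).symm x := by
  have : IsManifold 𝓘(ℝ, E) 1 M := .of_le (n := ∞) (by simp)
  have h := mdifferentiableWithinAt_extChartAt_symm hx
  rwa [ModelWithCorners.Boundaryless.range_eq_univ, mdifferentiableWithinAt_univ] at h

/-- The differential of the chart is a left inverse. Hence the chart expression of the metric is
positive definite on the whole chart target. -/
theorem mfderiv_symm_injective {p : M} {x : E}
    (hx : x ∈ (extChartAt 𝓘(ℝ, E) p).target) {v : E}
    (hv : mfderiv 𝓘(ℝ, E) 𝓘(ℝ, E) (extChartAt 𝓘(ℝ, E) p).symm x v = 0) : v = 0 := by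
  have : IsManifold 𝓘(ℝ, E) 1 M := .of_le (n := ∞) (by simp)
  have h := mfderiv_extChartAt_comp_mfderivWithin_extChartAt_symm hx
  rw [ModelWithCorners.Boundaryless.range_eq_univ, mfderivWithin_univ] at h
  let A : E →L[ℝ] E :=
    mfderiv 𝓘(ℝ, E) 𝓘(ℝ, E) (extChartAt 𝓘(ℝ, E) p) ((extChartAt 𝓘(ℝ, E) p).symm x)
  have h₁ := congrArg (fun B : E →L[ℝ] E ↦ B v) h
  exact h₁.symm.trans ((congrArg A hv).trans A.map_zero)

theorem mfderiv_symm_chartDeriv (p : M) (v : TangentSpace 𝓘(ℝ, E) p) :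
    mfderiv 𝓘(ℝ, E) 𝓘(ℝ, E) (extChartAt 𝓘(ℝ, E) p).symm (extChartAt 𝓘(ℝ, E) p p)
      (chartDeriv 𝓘(ℝ, E) p v) = v := by
  have : IsManifold 𝓘(ℝ, E) 1 M := .of_le (n := ∞) (by simp)
  have h := mfderivWithin_extChartAt_symm_comp_mfderiv_extChartAt' (I := 𝓘(ℝ, E))
    (mem_extChartAt_source (I := 𝓘(ℝ, E)) p)
  rw [ModelWithCorners.Boundaryless.range_eq_univ, mfderivWithin_univ] at h
  exact congrArg (fun A : E →L[ℝ] E ↦ A v) h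

theorem chartDeriv_surjective (p : M) : Function.Surjective (chartDeriv 𝓘(ℝ, E) p) := by
  have : IsManifold 𝓘(ℝ, E) 1 M := .of_le (n := ∞) (by simp)
  exact (isInvertible_mfderiv_extChartAt (mem_extChartAt_source p)).surjective

variable [FiniteDimensional ℝ E]
  (g : Bundle.ContMDiffRiemannianMetric 𝓘(ℝ, E) ∞ E (fun p : M ↦ TangentSpace 𝓘(ℝ, E) p))

theorem inChart_riemannianForm_apply (p : M) (x v w : E) :
    inChart (riemannianForm g) p x v w = g.inner ((extChartAt 𝓘(ℝ, E) p).symm x)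
      (mfderiv 𝓘(ℝ, E) 𝓘(ℝ, E) (extChartAt 𝓘(ℝ, E) p).symm x v)
      (mfderiv 𝓘(ℝ, E) 𝓘(ℝ, E) (extChartAt 𝓘(ℝ, E) p).symm x w) := rfl

theorem inChart_riemannianForm_symm (p : M) (x v w : E) :
    inChart (riemannianForm g) p x v w = inChart (riemannianForm g) p x w v :=
  g.symm _ _ _

theorem inChart_riemannianForm_pos {p : M} {x : E} (hx : x ∈ (extChartAt 𝓘(ℝ, E) p).target)
    (v : E) (hv : v ≠ 0) : 0 < inChart (riemannianForm g) p x v v :=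
  g.pos _ _ fun h ↦ hv (mfderiv_symm_injective hx h)

theorem inChart_chartDeriv (p : M) (v w : TangentSpace 𝓘(ℝ, E) p) :
    inChart (riemannianForm g) p (extChartAt 𝓘(ℝ, E) p p) (chartDeriv 𝓘(ℝ, E) p v)
      (chartDeriv 𝓘(ℝ, E) p w) = riemannianForm g p v w := by
  rw [inChart_riemannianForm_apply, mfderiv_symm_chartDeriv, mfderiv_symm_chartDeriv,
    extChartAt_to_inv]
  rfl

/-- Each entry contracts the smooth section `g` with two coordinate vector fields, all taken along
the inverse chart. -/
theorem contDiffAt_inChart_riemannianForm {p : M} {x : E}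
    (hx : x ∈ (extChartAt 𝓘(ℝ, E) p).target) :
    ContDiffAt ℝ ∞ (inChart (riemannianForm g) p) x := by
  refine contDiffAt_of_clm_apply fun v ↦ contDiffAt_of_clm_apply fun w ↦ ?_
  simp only [inChart_riemannianForm_apply]
  have hφ : ContMDiffAt 𝓘(ℝ, E) 𝓘(ℝ, E) ∞ (extChartAt 𝓘(ℝ, E) p).symm x := by
    have h := contMDiffOn_extChartAt_symm (I := 𝓘(ℝ, E)) (n := ∞) p
    exact h.contMDiffAt ((isOpen_extChartAt_target p).mem_nhds hx)
  have hv (v : E) : ContMDiffAt 𝓘(ℝ, E) (𝓘(ℝ, E).prod 𝓘(ℝ, E)) ∞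
      (fun y ↦ (⟨(extChartAt 𝓘(ℝ, E) p).symm y,
        mfderiv 𝓘(ℝ, E) 𝓘(ℝ, E) (extChartAt 𝓘(ℝ, E) p).symm y v⟩ : TangentBundle 𝓘(ℝ, E) M)) x := by
    -- The coordinate field is the tangent map of the inverse chart applied to the constant field
    -- `v`.
    have hT := (contMDiffOn_extChartAt_symm (I := 𝓘(ℝ, E)) (n := ∞) p).contMDiffOn_tangentMapWithin
      (m := ∞) (by simp) (isOpen_extChartAt_target p).uniqueMDiffOn
    have hT' := hT.contMDiffAt (x := (⟨x, v⟩ : TangentBundle 𝓘(ℝ, E) E))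
      (((isOpen_extChartAt_target p).preimage
        (FiberBundle.continuous_proj E (TangentSpace 𝓘(ℝ, E)))).mem_nhds hx)
    have hs : ContMDiffAt 𝓘(ℝ, E) (𝓘(ℝ, E).prod 𝓘(ℝ, E)) ∞
        (fun y ↦ (⟨y, v⟩ : TangentBundle 𝓘(ℝ, E) E)) x :=
      contMDiffAt_vectorSpace_iff_contDiffAt.2 contDiffAt_const
    refine (hT'.comp x hs).congr_of_eventuallyEq ?_
    filter_upwards [(isOpen_extChartAt_target p).mem_nhds hx] with y hy
    simp only [Function.comp_apply, tangentMapWithin]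
    rw [mfderivWithin_of_isOpen (isOpen_extChartAt_target p) hy]
  have hg : ContMDiffAt 𝓘(ℝ, E) (𝓘(ℝ, E).prod 𝓘(ℝ, E →L[ℝ] E →L[ℝ] ℝ)) ∞
      (fun y ↦ Bundle.TotalSpace.mk' (E →L[ℝ] E →L[ℝ] ℝ)
        (E := fun q : M ↦ TangentSpace 𝓘(ℝ, E) q →L[ℝ] TangentSpace 𝓘(ℝ, E) q →L[ℝ] ℝ)
        ((extChartAt 𝓘(ℝ, E) p).symm y) (g.inner ((extChartAt 𝓘(ℝ, E) p).symm y))) x :=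
    (g.contMDiff _).comp x hφ
  have h : ContMDiffAt 𝓘(ℝ, E) (𝓘(ℝ, E).prod 𝓘(ℝ)) ∞
      (fun y ↦ Bundle.TotalSpace.mk' ℝ (E := Bundle.Trivial M ℝ) ((extChartAt 𝓘(ℝ, E) p).symm y)
        (g.inner ((extChartAt 𝓘(ℝ, E) p).symm y)
          (mfderiv 𝓘(ℝ, E) 𝓘(ℝ, E) (extChartAt 𝓘(ℝ, E) p).symm y v)
          (mfderiv 𝓘(ℝ, E) 𝓘(ℝ, E) (extChartAt 𝓘(ℝ, E) p).symm y w))) x := by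
    apply ContMDiffAt.clm_bundle_apply₂ (F₁ := E) (F₂ := E)
    · exact hg
    · exact hv v
    · exact hv w
  simp only [Bundle.contMDiffAt_totalSpace] at h
  exact contMDiffAt_iff_contDiffAt.1 h.2

end Riemannian

/-! ### The static space-time in product charts -/

section StaticManifold

variable {E : Type*} [NormedAddCommGroup E] [NormedSpace ℝ E]
  {F : Type*} [TopologicalSpace F] [ChartedSpace E F] {t₁ t₂ : EReal}

/-- The differential of the time coordinate. -/
def timeForm (q : timeInterval t₁ t₂ × F) :
    TangentSpace (𝓘(ℝ, ℝ).prod 𝓘(ℝ, E)) q →L[ℝ] ℝ :=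
  mfderiv (𝓘(ℝ, ℝ).prod 𝓘(ℝ, E)) 𝓘(ℝ, ℝ) (fun q' : timeInterval t₁ t₂ × F ↦ (q'.1 : ℝ)) q

/-- The differential of the projection to the space factor. -/
def spaceProj (q : timeInterval t₁ t₂ × F) :
    TangentSpace (𝓘(ℝ, ℝ).prod 𝓘(ℝ, E)) q →L[ℝ] TangentSpace 𝓘(ℝ, E) q.2 :=
  mfderiv (𝓘(ℝ, ℝ).prod 𝓘(ℝ, E)) 𝓘(ℝ, E) (Prod.snd : timeInterval t₁ t₂ × F → F) q

theorem staticMetric_apply (f : F → ℝ) (gF : BilinField 𝓘(ℝ, E) F) (q : timeInterval t₁ t₂ × F)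
    (v w : TangentSpace (𝓘(ℝ, ℝ).prod 𝓘(ℝ, E)) q) :
    staticMetric t₁ t₂ f gF q v w = gF q.2 (spaceProj q v) (spaceProj q w)
      - f q.2 ^ 2 * (timeForm q v * timeForm q w) := rfl

theorem mdifferentiableAt_time (q : timeInterval t₁ t₂ × F) :
    MDifferentiableAt (𝓘(ℝ, ℝ).prod 𝓘(ℝ, E)) 𝓘(ℝ, ℝ)
      (fun q' : timeInterval t₁ t₂ × F ↦ (q'.1 : ℝ)) q :=
  ((contMDiff_subtype_val (n := 1)).mdifferentiable (by simp) q.1).comp q mdifferentiableAt_fst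

theorem spaceProj_tangentSum {t : timeInterval t₁ t₂} {p : F} (u : TangentSpace 𝓘(ℝ, ℝ) t)
    (v : TangentSpace 𝓘(ℝ, E) p) : spaceProj (t, p) (tangentSum u v) = v := by
  have h₁ : spaceProj (t, p) (mfderiv 𝓘(ℝ, ℝ) (𝓘(ℝ, ℝ).prod 𝓘(ℝ, E))
      (fun t' : timeInterval t₁ t₂ ↦ (t', p)) t u) = 0 := by
    have h := mfderiv_comp t (I := 𝓘(ℝ, ℝ)) (I' := 𝓘(ℝ, ℝ).prod 𝓘(ℝ, E)) (I'' := 𝓘(ℝ, E))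
      (g := (Prod.snd : timeInterval t₁ t₂ × F → F)) (f := fun t' : timeInterval t₁ t₂ ↦ (t', p))
      mdifferentiableAt_snd (mdifferentiableAt_id.prodMk mdifferentiableAt_const)
    have h' : mfderiv 𝓘(ℝ, ℝ) 𝓘(ℝ, E) (fun _ : timeInterval t₁ t₂ ↦ p) t = 0 := mfderiv_const
    exact (congrArg (fun A : ℝ →L[ℝ] E ↦ A u) (h.symm.trans h') :)
  have h₂ : spaceProj (t, p) (mfderiv 𝓘(ℝ, E) (𝓘(ℝ, ℝ).prod 𝓘(ℝ, E))
      (fun p' : F ↦ (t, p')) p v) = v := by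
    have h := mfderiv_comp p (I := 𝓘(ℝ, E)) (I' := 𝓘(ℝ, ℝ).prod 𝓘(ℝ, E)) (I'' := 𝓘(ℝ, E))
      (g := (Prod.snd : timeInterval t₁ t₂ × F → F)) (f := fun p' : F ↦ (t, p'))
      mdifferentiableAt_snd (mdifferentiableAt_const.prodMk mdifferentiableAt_id)
    have h' := mfderiv_id (I := 𝓘(ℝ, E)) (x := p)
    exact (congrArg (fun A : E →L[ℝ] E ↦ A v) (h.symm.trans h') :)
  rw [tangentSum, map_add, h₁, h₂, zero_add]

/-- The preferred chart of the interval is its inclusion in the line, whatever the base point. -/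
theorem extChartAt_static_apply (q q' : timeInterval t₁ t₂ × F) :
    extChartAt (𝓘(ℝ, ℝ).prod 𝓘(ℝ, E)) q q' = ((q'.1 : ℝ), extChartAt 𝓘(ℝ, E) q.2 q'.2) := rfl

theorem extChartAt_static_symm_fst {q : timeInterval t₁ t₂ × F} {y : ℝ × E}
    (hy : y ∈ (extChartAt (𝓘(ℝ, ℝ).prod 𝓘(ℝ, E)) q).target) :
    (((extChartAt (𝓘(ℝ, ℝ).prod 𝓘(ℝ, E)) q).symm y).1 : ℝ) = y.1 := by
  have h := (extChartAt (𝓘(ℝ, ℝ).prod 𝓘(ℝ, E)) q).right_inv hy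
  rw [extChartAt_static_apply] at h
  exact congrArg Prod.fst h

theorem extChartAt_static_target_snd {q : timeInterval t₁ t₂ × F} {y : ℝ × E}
    (hy : y ∈ (extChartAt (𝓘(ℝ, ℝ).prod 𝓘(ℝ, E)) q).target) :
    y.2 ∈ (extChartAt 𝓘(ℝ, E) q.2).target := by
  rw [extChartAt_prod] at hy
  exact hy.2

variable [IsManifold 𝓘(ℝ, E) ∞ F]

theorem chartDeriv_static (q : timeInterval t₁ t₂ × F)
    (w : TangentSpace (𝓘(ℝ, ℝ).prod 𝓘(ℝ, E)) q) :
    chartDeriv (𝓘(ℝ, ℝ).prod 𝓘(ℝ, E)) q w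
      = (timeForm q w, chartDeriv 𝓘(ℝ, E) q.2 (spaceProj q w)) := by
  have : IsManifold 𝓘(ℝ, E) 1 F := .of_le (n := ∞) (by simp)
  have hq : MDifferentiableAt (𝓘(ℝ, ℝ).prod 𝓘(ℝ, E)) 𝓘(ℝ, ℝ × E)
      (extChartAt (𝓘(ℝ, ℝ).prod 𝓘(ℝ, E)) q) q :=
    mdifferentiableAt_extChartAt (mem_chart_source _ q)
  refine Prod.ext ?_ ?_
  · have h := mfderiv_comp q (I' := 𝓘(ℝ, ℝ × E)) (I'' := 𝓘(ℝ, ℝ))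
      (g := (Prod.fst : ℝ × E → ℝ)) differentiableAt_fst.mdifferentiableAt hq
    rw [mfderiv_eq_fderiv, fderiv_fst] at h
    exact (congrArg (fun A : (ℝ × E) →L[ℝ] ℝ ↦ A w) h.symm :)
  · have h := mfderiv_comp q (I' := 𝓘(ℝ, ℝ × E)) (I'' := 𝓘(ℝ, E))
      (g := (Prod.snd : ℝ × E → E)) differentiableAt_snd.mdifferentiableAt hq
    rw [mfderiv_eq_fderiv, fderiv_snd] at h
    have h' := mfderiv_comp q (I := 𝓘(ℝ, ℝ).prod 𝓘(ℝ, E)) (I' := 𝓘(ℝ, E)) (I'' := 𝓘(ℝ, E))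
      (f := (Prod.snd : timeInterval t₁ t₂ × F → F)) (g := extChartAt 𝓘(ℝ, E) q.2)
      (mdifferentiableAt_extChartAt (mem_chart_source _ q.2)) mdifferentiableAt_snd
    exact (congrArg (fun A : (ℝ × E) →L[ℝ] E ↦ A w) (h.symm.trans h') :)

variable [FiniteDimensional ℝ E]
  (g : Bundle.ContMDiffRiemannianMetric 𝓘(ℝ, E) ∞ E (fun p : F ↦ TangentSpace 𝓘(ℝ, E) p))

/-- By the chain rule, pulling `dt` and the projection differential back along the inverse product
chart gives the first coordinate and the inverse chart differential of `F` on the second. -/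
theorem inChart_static {f : F → ℝ} {q : timeInterval t₁ t₂ × F} {y : ℝ × E}
    (hy : y ∈ (extChartAt (𝓘(ℝ, ℝ).prod 𝓘(ℝ, E)) q).target) :
    inChart (staticMetric t₁ t₂ f (riemannianForm g)) q y
      = coordStatic (f ∘ (extChartAt 𝓘(ℝ, E) q.2).symm) (inChart (riemannianForm g) q.2) y := by
  have : IsManifold 𝓘(ℝ, E) 1 F := .of_le (n := ∞) (by simp)
  have hψ : MDifferentiableAt 𝓘(ℝ, ℝ × E) (𝓘(ℝ, ℝ).prod 𝓘(ℝ, E))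
      (extChartAt (𝓘(ℝ, ℝ).prod 𝓘(ℝ, E)) q).symm y := by
    have h := mdifferentiableWithinAt_extChartAt_symm hy
    rwa [ModelWithCorners.Boundaryless.range_eq_univ, mdifferentiableWithinAt_univ] at h
  have htime (V : ℝ × E) : timeForm ((extChartAt (𝓘(ℝ, ℝ).prod 𝓘(ℝ, E)) q).symm y)
      (mfderiv 𝓘(ℝ, ℝ × E) (𝓘(ℝ, ℝ).prod 𝓘(ℝ, E))
        (extChartAt (𝓘(ℝ, ℝ).prod 𝓘(ℝ, E)) q).symm y V) = V.1 := by
    have h := mfderiv_comp y (I'' := 𝓘(ℝ, ℝ)) (mdifferentiableAt_time _) hψ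
    have h' : (fun q' : timeInterval t₁ t₂ × F ↦ (q'.1 : ℝ)) ∘
        (extChartAt (𝓘(ℝ, ℝ).prod 𝓘(ℝ, E)) q).symm =ᶠ[𝓝 y] Prod.fst := by
      filter_upwards [(isOpen_extChartAt_target q).mem_nhds hy] with z hz
        using extChartAt_static_symm_fst hz
    rw [h'.mfderiv_eq, mfderiv_eq_fderiv, fderiv_fst] at h
    exact (congrArg (fun A : (ℝ × E) →L[ℝ] ℝ ↦ A V) h.symm :)
  have hspace (V : ℝ × E) : spaceProj ((extChartAt (𝓘(ℝ, ℝ).prod 𝓘(ℝ, E)) q).symm y)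
      (mfderiv 𝓘(ℝ, ℝ × E) (𝓘(ℝ, ℝ).prod 𝓘(ℝ, E))
        (extChartAt (𝓘(ℝ, ℝ).prod 𝓘(ℝ, E)) q).symm y V)
      = mfderiv 𝓘(ℝ, E) 𝓘(ℝ, E) (extChartAt 𝓘(ℝ, E) q.2).symm y.2 V.2 := by
    have h := mfderiv_comp y (I'' := 𝓘(ℝ, E)) (g := (Prod.snd : timeInterval t₁ t₂ × F → F))
      mdifferentiableAt_snd hψ
    have h' := mfderiv_comp y (I := 𝓘(ℝ, ℝ × E)) (I' := 𝓘(ℝ, E)) (I'' := 𝓘(ℝ, E))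
      (f := (Prod.snd : ℝ × E → E)) (g := (extChartAt 𝓘(ℝ, E) q.2).symm)
      (mdifferentiableAt_extChartAt_symm' (extChartAt_static_target_snd hy))
      differentiableAt_snd.mdifferentiableAt
    rw [mfderiv_eq_fderiv, fderiv_snd] at h'
    exact (congrArg (fun A : (ℝ × E) →L[ℝ] E ↦ A V) (h.symm.trans h') :)
  refine ContinuousLinearMap.ext fun V ↦ ContinuousLinearMap.ext fun W ↦ ?_
  rw [coordStatic_apply]
  refine (staticMetric_apply f (riemannianForm g) _ _ _).trans ?_
  refine congrArg₂ (fun a b : ℝ ↦ a - b) ?_ ?_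
  · exact congrArg₂ (fun a b : E ↦ g.inner ((extChartAt 𝓘(ℝ, E) q.2).symm y.2) a b)
      (hspace V) (hspace W)
  · exact congrArg₂ (fun a b : ℝ ↦ f ((extChartAt 𝓘(ℝ, E) q.2).symm y.2) ^ 2 * (a * b))
      (htime V) (htime W)

/-- Einstein's equation of a standard static space-time. -/
theorem einstein_static {f : F → ℝ} (hf : ContMDiff 𝓘(ℝ, E) 𝓘(ℝ, ℝ) ∞ f) (hf_pos : ∀ p, 0 < f p)
    {T : BilinField (𝓘(ℝ, ℝ).prod 𝓘(ℝ, E)) (timeInterval t₁ t₂ × F)}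
    (hT : EinsteinEquation (staticMetric t₁ t₂ f (riemannianForm g)) T)
    (q : timeInterval t₁ t₂ × F) (w : TangentSpace (𝓘(ℝ, ℝ).prod 𝓘(ℝ, E)) q) :
    8 * Real.pi * T q w w = ricci (riemannianForm g) q.2 (spaceProj q w) (spaceProj q w)
      + 1 / f q.2 * qTensor (riemannianForm g) f q.2 (spaceProj q w) (spaceProj q w)
      - 1 / 2 * scalarCurvature (riemannianForm g) q.2
        * staticMetric t₁ t₂ f (riemannianForm g) q w w := by
  set y : ℝ × E := extChartAt (𝓘(ℝ, ℝ).prod 𝓘(ℝ, E)) q q with hy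
  have hy₂ : y.2 = extChartAt 𝓘(ℝ, E) q.2 q.2 := rfl
  have hmem : y.2 ∈ (extChartAt 𝓘(ℝ, E) q.2).target := mem_extChartAt_target q.2
  -- Agreement near `y` suffices, by `coordRicci_congr`.
  have hev : inChart (staticMetric t₁ t₂ f (riemannianForm g)) q =ᶠ[𝓝 y]
      coordStatic (f ∘ (extChartAt 𝓘(ℝ, E) q.2).symm) (inChart (riemannianForm g) q.2) := by
    filter_upwards [extChartAt_target_mem_nhds q] with z hz using inChart_static g hz
  have hfy : (f ∘ (extChartAt 𝓘(ℝ, E) q.2).symm) y.2 = f q.2 :=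
    congrArg f (extChartAt_to_inv q.2)
  have hf' : ContDiffAt ℝ 2 (f ∘ (extChartAt 𝓘(ℝ, E) q.2).symm) y.2 := by
    have h := (contMDiffOn_extChartAt_symm (I := 𝓘(ℝ, E)) (n := ∞) q.2).contMDiffAt
      ((isOpen_extChartAt_target q.2).mem_nhds hmem)
    exact ((hf _).comp _ h).contDiffAt.of_le (by norm_cast)
  have key := coordEinstein_coordStatic (y := y) (f := f ∘ (extChartAt 𝓘(ℝ, E) q.2).symm)
    (G := inChart (riemannianForm g) q.2)
    ((contDiffAt_inChart_riemannianForm g hmem).of_le (by norm_cast))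
    (by
      filter_upwards [(isOpen_extChartAt_target q.2).mem_nhds hmem] with x hx
        using isInvertible_of_pos _ (inChart_riemannianForm_pos g hx))
    (Eventually.of_forall fun x ↦ inChart_riemannianForm_symm g q.2 x) hf'
    (by rw [hfy]; exact (hf_pos _).ne') (chartDeriv (𝓘(ℝ, ℝ).prod 𝓘(ℝ, E)) q w)
  have hV : (chartDeriv (𝓘(ℝ, ℝ).prod 𝓘(ℝ, E)) q w).2
    = chartDeriv 𝓘(ℝ, E) q.2 (spaceProj q w) := by rw [chartDeriv_static]
  have hS : coordStatic (f ∘ (extChartAt 𝓘(ℝ, E) q.2).symm) (inChart (riemannianForm g) q.2) y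
      (chartDeriv (𝓘(ℝ, ℝ).prod 𝓘(ℝ, E)) q w) (chartDeriv (𝓘(ℝ, ℝ).prod 𝓘(ℝ, E)) q w)
      = staticMetric t₁ t₂ f (riemannianForm g) q w w := by
    rw [coordStatic_apply, hfy, staticMetric_apply, hV, hy₂, inChart_chartDeriv, chartDeriv_static]
  have hT' : ricci (staticMetric t₁ t₂ f (riemannianForm g)) q w w
      - 1 / 2 * scalarCurvature (staticMetric t₁ t₂ f (riemannianForm g)) q
        * staticMetric t₁ t₂ f (riemannianForm g) q w w = 8 * Real.pi * T q w w :=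
    congrArg (fun B : LinearMap.BilinForm ℝ (TangentSpace (𝓘(ℝ, ℝ).prod 𝓘(ℝ, E)) q) ↦ B w w) (hT q)
  rw [hS, hV, hfy, hy₂, inChart_chartDeriv] at key
  rw [← hT', ricci, scalarCurvature, ← hy, coordRicci_congr hev, hev.self_of_nhds]
  exact key

/-- The trace is taken against a positive definite form, and every coordinate vector comes from a
tangent vector. -/
theorem scalarCurvature_nonneg (h : PosSemidef (ricci (riemannianForm g))) (p : F) :
    0 ≤ scalarCurvature (riemannianForm g) p := by
  refine formTrace_nonneg (inChart_riemannianForm_pos g (mem_extChartAt_target p))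
    (inChart_riemannianForm_symm g p _) fun v ↦ ?_
  obtain ⟨w, rfl⟩ := chartDeriv_surjective p v
  exact h p w

theorem scalarCurvature_nonpos (h : NegSemidef (ricci (riemannianForm g))) (p : F) :
    scalarCurvature (riemannianForm g) p ≤ 0 := by
  refine formTrace_nonpos (inChart_riemannianForm_pos g (mem_extChartAt_target p))
    (inChart_riemannianForm_symm g p _) fun v ↦ ?_
  obtain ⟨w, rfl⟩ := chartDeriv_surjective p v
  exact h p w

end StaticManifold

theorem timeInterval_nonempty {t₁ t₂ : EReal} (ht : t₁ < t₂) : Nonempty (timeInterval t₁ t₂) := by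
  obtain ⟨t, h₁, h₂⟩ := EReal.exists_between_coe_real ht
  exact ⟨⟨t, h₁, h₂⟩⟩

end SemiRiemannian

end

/-! ### Sign conclusions -/

theorem mainTheorem7
    {E : Type*} [NormedAddCommGroup E] [NormedSpace ℝ E] [FiniteDimensional ℝ E]
    {F : Type*} [TopologicalSpace F] [T2Space F] [SecondCountableTopology F] [ConnectedSpace F]
    [ChartedSpace E F] [IsManifold 𝓘(ℝ, E) ∞ F]
    (gF : Bundle.ContMDiffRiemannianMetric 𝓘(ℝ, E) ∞ E (fun p : F ↦ TangentSpace 𝓘(ℝ, E) p))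
    (f : F → ℝ) (hf : ContMDiff 𝓘(ℝ, E) 𝓘(ℝ, ℝ) ∞ f) (hf_pos : ∀ p, 0 < f p)
    (t₁ t₂ : EReal) (ht : t₁ < t₂)
    (T : BilinField (𝓘(ℝ, ℝ).prod 𝓘(ℝ, E)) (timeInterval t₁ t₂ × F))
    (hT : EinsteinEquation (staticMetric t₁ t₂ f (riemannianForm gF)) T) :
    (PosSemidef (ricci (riemannianForm gF)) → PosSemidef (qTensor (riemannianForm gF) f) →
      ∀ (q : timeInterval t₁ t₂ × F) (w : TangentSpace (𝓘(ℝ, ℝ).prod 𝓘(ℝ, E)) q),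
        IsCausal (staticMetric t₁ t₂ f (riemannianForm gF)) w → 0 ≤ T q w w) ∧
    (NegSemidef (ricci (riemannianForm gF)) → NegSemidef (qTensor (riemannianForm gF) f) →
      ∀ (q : timeInterval t₁ t₂ × F) (w : TangentSpace (𝓘(ℝ, ℝ).prod 𝓘(ℝ, E)) q),
        IsCausal (staticMetric t₁ t₂ f (riemannianForm gF)) w → T q w w ≤ 0) ∧
    ((∀ p, ricci (riemannianForm gF) p = 0) →
      (∀ (t : timeInterval t₁ t₂) (p : F) (u : TangentSpace 𝓘(ℝ, ℝ) t)
          (v : TangentSpace 𝓘(ℝ, E) p),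
        8 * Real.pi * T (t, p) (tangentSum u v) (tangentSum u v)
          = 1 / f p * qTensor (riemannianForm gF) f p v v) ∧
      (PosSemidef (qTensor (riemannianForm gF) f) ↔
        ∀ (q : timeInterval t₁ t₂ × F) (w : TangentSpace (𝓘(ℝ, ℝ).prod 𝓘(ℝ, E)) q),
          0 ≤ T q w w)) := by
  have h8 : (0 : ℝ) < 8 * Real.pi := by positivity
  have hE := einstein_static gF hf hf_pos hT
  refine ⟨fun hR hQ q w hw ↦ ?_, fun hR hQ q w hw ↦ ?_, fun hR ↦ ?_⟩
  · refine nonneg_of_mul_nonneg_right ?_ h8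
    rw [hE q w]
    have h₁ := hR q.2 (spaceProj q w)
    have h₂ := mul_nonneg (one_div_pos.2 (hf_pos q.2)).le (hQ q.2 (spaceProj q w))
    -- Causality enters here: `τ_F ≥ 0` and `g(w,w) ≤ 0`, so the last term of the identity
    -- contributes nonnegatively.
    have h₃ := mul_nonpos_of_nonneg_of_nonpos (scalarCurvature_nonneg gF hR q.2) hw.2
    linarith
  · refine nonpos_of_mul_nonpos_right ?_ h8
    rw [hE q w]
    have h₁ := hR q.2 (spaceProj q w)
    have h₂ := mul_nonpos_of_nonneg_of_nonpos (one_div_pos.2 (hf_pos q.2)).le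
      (hQ q.2 (spaceProj q w))
    have h₃ := mul_nonneg_of_nonpos_of_nonpos (scalarCurvature_nonpos gF hR q.2) hw.2
    linarith
  -- A zero Ricci tensor is semi-definite of both signs, so its trace vanishes.
  · have hτ (p : F) : scalarCurvature (riemannianForm gF) p = 0 :=
      le_antisymm (scalarCurvature_nonpos gF (fun p v ↦ by simp [hR p]) p)
        (scalarCurvature_nonneg gF (fun p v ↦ by simp [hR p]) p)
    have hE' (q : timeInterval t₁ t₂ × F) (w : TangentSpace (𝓘(ℝ, ℝ).prod 𝓘(ℝ, E)) q) :
        8 * Real.pi * T q w w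
          = 1 / f q.2 * qTensor (riemannianForm gF) f q.2 (spaceProj q w) (spaceProj q w) := by
      rw [hE q w, hR, hτ]
      simp
    have hsum (t : timeInterval t₁ t₂) (p : F) (u : TangentSpace 𝓘(ℝ, ℝ) t)
        (v : TangentSpace 𝓘(ℝ, E) p) : 8 * Real.pi * T (t, p) (tangentSum u v) (tangentSum u v)
          = 1 / f p * qTensor (riemannianForm gF) f p v v := by
      rw [hE', spaceProj_tangentSum]
    refine ⟨hsum, fun hQ q w ↦ ?_, fun hTpos p v ↦ ?_⟩
    · refine nonneg_of_mul_nonneg_right ?_ h8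
      rw [hE' q w]
      exact mul_nonneg (one_div_pos.2 (hf_pos q.2)).le (hQ q.2 (spaceProj q w))
    -- Some time `t` exists because `t₁ < t₂`; the vector with `u = 0` already detects `Q(v,v)`.
    · obtain ⟨t⟩ := timeInterval_nonempty ht
      refine nonneg_of_mul_nonneg_right ?_ (one_div_pos.2 (hf_pos p))
      rw [← hsum t p 0 v]
      exact mul_nonneg h8.le (hTpos _ _)
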